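/- Let $\mu,\theta\in\mathbb{R}$ with $\mu>0$ and $|\mu\cos\pi\theta|>1$, and put $q=e^{2\pi i\theta}$ and $z=\dfrac{e^{i\pi\theta}}{2i\cos\pi\theta}$. Let $A^0_{\mu,\theta}$ be the quotient of the free unital complex $\ast$-algebra $\mathbb{C}\langle W,W^*,\Lambda,\Lambda^*\rangle$ by the two-sided ideal generated by the relations $$W\Lambda=q\Lambda W,\quad W^*\Lambda=\bar q\Lambda W^*,\quad W^*\Lambda^*=q\Lambda^*W^*,\quad W\Lambda^*=\bar q\Lambda^*W,\quad \Lambda^*\Lambda=\Lambda\Lambda^*=1,$$ $$WW^*=z\Lambda+\bar z\Lambda^*+\mu 1,\qquad W^*W=-\bar z\Lambda-z\Lambda^*+\mu 1.$$ Let $C_\theta$ be the noncommutative torus, i.e. the universal unital $C^*$-algebra generated by $U,V$ subject to $VU=e^{2\pi i\theta}UV$, $U^*U=UU^*=1$, $V^*V=VV^*=1$. Then the element $R=\mu 1+zU+\bar zU^*$ of $C_\theta$ is positive and invertible, and there is a unique unital $\ast$-homomorphism $\phi:A^0_{\mu,\theta}\to C_\theta$ with $$\phi(W)=\sqrt{R}\,V,\qquad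 \phi(\Lambda)=U,$$ where $\sqrt R$ is the positive square root of $R$. Moreover, $\phi$ is injective. -/

import Mathlib

noncomputable section

/-! ### The free unital `*`-algebra over `ℂ` -/

/-- The free unital complex `*`-algebra `ℂ⟨x, x* : x ∈ X⟩`: the free algebra on two copies of `X`,
where the letter `Sum.inl x` is `x` and the letter `Sum.inr x` is `x*`. -/
def FreeStarAlg (X : Type) : Type := FreeAlgebra ℂ (X ⊕ X)

namespace FreeStarAlg

variable {X : Type}

instance : Ring (FreeStarAlg X) := inferInstanceAs (Ring (FreeAlgebra ℂ (X ⊕ X)))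

instance : Algebra ℂ (FreeStarAlg X) := inferInstanceAs (Algebra ℂ (FreeAlgebra ℂ (X ⊕ X)))

/-- A letter of the alphabet `X ⊔ X*`. -/
def letter (s : X ⊕ X) : FreeStarAlg X := FreeAlgebra.ι ℂ s

/-- The generator `x`. -/
def of (x : X) : FreeStarAlg X := letter (Sum.inl x)

theorem induct {P : FreeStarAlg X → Prop}
    (scalar : ∀ c : ℂ, P (algebraMap ℂ (FreeStarAlg X) c)) (gen : ∀ s, P (letter s))
    (mul : ∀ a b, P a → P b → P (a * b)) (add : ∀ a b, P a → P b → P (a + b))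
    (a : FreeStarAlg X) : P a :=
  FreeAlgebra.induction ℂ (X ⊕ X) (motive := P) scalar gen mul add a

/-- The extension of a map on letters to an algebra homomorphism. -/
def algLift {A : Type*} [Ring A] [Algebra ℂ A] (f : X ⊕ X → A) : FreeStarAlg X →ₐ[ℂ] A :=
  FreeAlgebra.lift ℂ f

@[simp] theorem algLift_letter {A : Type*} [Ring A] [Algebra ℂ A] (f : X ⊕ X → A) (s : X ⊕ X) :
    algLift f (letter s) = f s :=
  FreeAlgebra.lift_ι_apply f s

/-- The conjugate-linear anti-multiplicative map exchanging `x` and `x*`, as a ring homomorphism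
into the opposite ring. -/
def starAux : FreeStarAlg X →+* (FreeStarAlg X)ᵐᵒᵖ :=
  letI : Algebra ℂ (FreeStarAlg X)ᵐᵒᵖ := Algebra.compHom _ (starRingEnd ℂ)
  (FreeAlgebra.lift ℂ (fun s : X ⊕ X => MulOpposite.op (letter s.swap)) :
    FreeAlgebra ℂ (X ⊕ X) →ₐ[ℂ] (FreeStarAlg X)ᵐᵒᵖ).toRingHom

theorem starAux_letter (s : X ⊕ X) :
    starAux (letter s) = MulOpposite.op (letter s.swap) := by
  let _ : Algebra ℂ (FreeStarAlg X)ᵐᵒᵖ := Algebra.compHom _ (starRingEnd ℂ)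
  exact FreeAlgebra.lift_ι_apply (R := ℂ)
    (fun s : X ⊕ X => MulOpposite.op (letter (X := X) s.swap)) s

theorem starAux_algebraMap (c : ℂ) :
    starAux (algebraMap ℂ (FreeStarAlg X) c)
      = MulOpposite.op (algebraMap ℂ (FreeStarAlg X) (starRingEnd ℂ c)) := by
  let _ : Algebra ℂ (FreeStarAlg X)ᵐᵒᵖ := Algebra.compHom _ (starRingEnd ℂ)
  exact (FreeAlgebra.lift ℂ (fun s : X ⊕ X => MulOpposite.op (letter (X := X) s.swap))).commutes c

instance : StarRing (FreeStarAlg X) where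
  star a := (starAux a).unop
  star_involutive a := by
    change (starAux (starAux a).unop).unop = a
    induction a using induct with
    | scalar c => simp [starAux_algebraMap]
    | gen s => simp [starAux_letter]
    | mul a b ha hb => simp [ha, hb]
    | add a b ha hb => simp [ha, hb]
  star_mul a b := by
    change (starAux (a * b)).unop = (starAux b).unop * (starAux a).unop
    simp
  star_add a b := by
    change (starAux (a + b)).unop = (starAux a).unop + (starAux b).unop
    simp

theorem star_letter (s : X ⊕ X) : star (letter s) = letter s.swap := by
  change (starAux (letter s)).unop = _
  rw [starAux_letter]; rfl

theorem star_scalar (c : ℂ) :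
    star (algebraMap ℂ (FreeStarAlg X) c) = algebraMap ℂ (FreeStarAlg X) (star c) := by
  change (starAux _).unop = _
  rw [starAux_algebraMap]; rfl

instance : StarModule ℂ (FreeStarAlg X) where
  star_smul c a := by
    rw [Algebra.smul_def, star_mul, star_scalar, Algebra.smul_def, Algebra.commutes]

/-- The universal property: a map from `X` to a `*`-algebra extends to a `*`-homomorphism. -/
def lift {A : Type*} [Ring A] [StarRing A] [Algebra ℂ A] [StarModule ℂ A] (f : X → A) :
    FreeStarAlg X →⋆ₐ[ℂ] A where
  toAlgHom := algLift (Sum.elim f (fun x => star (f x)))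
  map_star' a := by
    change algLift (Sum.elim f (fun x => star (f x))) (star a)
      = star (algLift (Sum.elim f (fun x => star (f x))) a)
    induction a using induct with
    | scalar c => rw [star_scalar, AlgHom.commutes, AlgHom.commutes, algebraMap_star_comm]
    | gen s => cases s <;> simp [star_letter]
    | mul a b ha hb => rw [star_mul, map_mul, map_mul, star_mul, ha, hb]
    | add a b ha hb => rw [star_add, map_add, map_add, star_add, ha, hb]

@[simp] theorem lift_of {A : Type*} [Ring A] [StarRing A] [Algebra ℂ A] [StarModule ℂ A]
    (f : X → A) (x : X) : lift f (of x) = f x :=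
  algLift_letter _ _

theorem hom_ext {A : Type*} [Ring A] [StarRing A] [Algebra ℂ A]
    {f g : FreeStarAlg X →⋆ₐ[ℂ] A} (h : ∀ x, f (of x) = g (of x)) : f = g := by
  ext a
  induction a using induct with
  | scalar c => rw [AlgHomClass.commutes, AlgHomClass.commutes]
  | gen s =>
    cases s with
    | inl x => exact h x
    | inr x =>
      have e : letter (Sum.inr x) = star (of x) := (star_letter (Sum.inl x)).symm
      rw [e, map_star, map_star, h]
  | mul a b ha hb => rw [map_mul, map_mul, ha, hb]
  | add a b ha hb => rw [map_add, map_add, ha, hb]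

end FreeStarAlg

/-! ### The constants -/

/-- `q = e^{2πiθ}`. -/
def qPar (θ : ℝ) : ℂ := Complex.exp (2 * Real.pi * Complex.I * θ)

/-- `z = e^{iπθ} / (2i cos πθ)`. -/
def zPar (θ : ℝ) : ℂ :=
  Complex.exp (Complex.I * Real.pi * θ) / (2 * Complex.I * Complex.cos (Real.pi * θ))

theorem qPar_mul_star (θ : ℝ) : qPar θ * star (qPar θ) = 1 := by
  have h : qPar θ = Complex.exp ((2 * Real.pi * θ : ℝ) * Complex.I) := by
    unfold qPar; congr 1; push_cast; ring
  rw [Complex.star_def, Complex.mul_conj, Complex.normSq_eq_norm_sq, h,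
    Complex.norm_exp_ofReal_mul_I]
  simp

/-! ### The `*`-algebra `A⁰_{μ,θ}` -/

/-- The two generators `W` and `Λ`. -/
inductive AGen : Type
  | W : AGen
  | L : AGen

namespace AZero

open FreeStarAlg

/-- The free `*`-algebra `ℂ⟨W, W*, Λ, Λ*⟩`. -/
abbrev Free : Type := FreeStarAlg AGen

/-- The letter `W`. -/
abbrev fW : Free := of AGen.W

/-- The letter `Λ`. -/
abbrev fL : Free := of AGen.L

/-- The defining relations `r = 0`. -/
inductive Rel (μ θ : ℝ) : Free → Prop
  | WL : Rel μ θ (fW * fL - qPar θ • (fL * fW))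
  | WsL : Rel μ θ (star fW * fL - star (qPar θ) • (fL * star fW))
  | WsLs : Rel μ θ (star fW * star fL - qPar θ • (star fL * star fW))
  | WLs : Rel μ θ (fW * star fL - star (qPar θ) • (star fL * fW))
  | LsL : Rel μ θ (star fL * fL - 1)
  | LLs : Rel μ θ (fL * star fL - 1)
  | WWs : Rel μ θ (fW * star fW
      - (zPar θ • fL + star (zPar θ) • star fL + (μ : ℂ) • (1 : Free)))
  | WsW : Rel μ θ (star fW * fW
      - (-(star (zPar θ) • fL) - zPar θ • star fL + (μ : ℂ) • (1 : Free)))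

/-- The two-sided ideal generated by the relations. -/
def relIdeal (μ θ : ℝ) : TwoSidedIdeal Free := TwoSidedIdeal.span {r | Rel μ θ r}

/-- The ideal generated by the relations is stable under `*`. -/
theorem star_mem_relIdeal (μ θ : ℝ) {a : Free} (ha : a ∈ relIdeal μ θ) :
    star a ∈ relIdeal μ θ := by
  have hq : qPar θ * star (qPar θ) = 1 := qPar_mul_star θ
  have hq' : star (qPar θ) * qPar θ = 1 := by rw [mul_comm, hq]
  have hsm : ∀ (c : ℂ) (x : Free), x ∈ relIdeal μ θ → c • x ∈ relIdeal μ θ := fun c x hx => by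
    rw [Algebra.smul_def]; exact (relIdeal μ θ).mul_mem_left _ _ hx
  have hgen : ∀ r, Rel μ θ r → r ∈ relIdeal μ θ := fun r hr => TwoSidedIdeal.subset_span hr
  induction ha using TwoSidedIdeal.span_induction with
  | mem x hx =>
    rcases hx with _ | _ | _ | _ | _ | _ | _ | _
    · have := hsm (-star (qPar θ)) _ (hgen _ Rel.WsLs)
      rw [smul_sub, smul_smul, neg_mul, hq'] at this
      convert this using 1
      simp only [star_sub, star_mul, star_smul, neg_smul, one_smul]; abel
    · have := hsm (-qPar θ) _ (hgen _ Rel.WLs)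
      rw [smul_sub, smul_smul, neg_mul, hq] at this
      convert this using 1
      simp only [star_sub, star_mul, star_smul, star_star, neg_smul, one_smul]; abel
    · have := hsm (-star (qPar θ)) _ (hgen _ Rel.WL)
      rw [smul_sub, smul_smul, neg_mul, hq'] at this
      convert this using 1
      simp only [star_sub, star_mul, star_smul, star_star, neg_smul, one_smul]; abel
    · have := hsm (-qPar θ) _ (hgen _ Rel.WsL)
      rw [smul_sub, smul_smul, neg_mul, hq] at this
      convert this using 1
      simp only [star_sub, star_mul, star_smul, star_star, neg_smul, one_smul]; abel
    · convert hgen _ Rel.LsL using 1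
      simp
    · convert hgen _ Rel.LLs using 1
      simp
    · convert hgen _ Rel.WWs using 1
      simp only [star_sub, star_add, star_mul, star_smul, star_star, star_one, Complex.star_def,
        Complex.conj_ofReal, Complex.conj_conj]; abel
    · convert hgen _ Rel.WsW using 1
      simp only [star_sub, star_add, star_neg, star_mul, star_smul, star_star, star_one,
        Complex.star_def, Complex.conj_ofReal, Complex.conj_conj]; abel
  | zero => rw [star_zero]; exact (relIdeal μ θ).zero_mem
  | add x y _ _ hx hy => rw [star_add]; exact (relIdeal μ θ).add_mem hx hy
  | neg x _ hx => rw [star_neg]; exact (relIdeal μ θ).neg_mem hx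
  | left_absorb a x _ hx => rw [star_mul]; exact (relIdeal μ θ).mul_mem_right _ _ hx
  | right_absorb b x _ hx => rw [star_mul]; exact (relIdeal μ θ).mul_mem_left _ _ hx

end AZero

/-- The `*`-algebra `A⁰_{μ,θ}`: the quotient of `ℂ⟨W, W*, Λ, Λ*⟩` by the two-sided ideal generated
by the relations. -/
def AZero (μ θ : ℝ) : Type := (AZero.relIdeal μ θ).ringCon.Quotient

namespace AZero

variable {μ θ : ℝ}

instance : Ring (AZero μ θ) := inferInstanceAs (Ring (relIdeal μ θ).ringCon.Quotient)

instance : Algebra ℂ (AZero μ θ) := inferInstanceAs (Algebra ℂ (relIdeal μ θ).ringCon.Quotient)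

/-- The quotient map. -/
def mk (μ θ : ℝ) : Free →ₐ[ℂ] AZero μ θ := (relIdeal μ θ).ringCon.mkₐ (α := ℂ)

theorem mk_surjective : Function.Surjective (mk μ θ) :=
  RingCon.mkₐ_surjective (α := ℂ) (relIdeal μ θ).ringCon

theorem mk_eq_mk {a b : Free} : mk μ θ a = mk μ θ b ↔ a - b ∈ relIdeal μ θ := by
  rw [← TwoSidedIdeal.rel_iff]
  exact (relIdeal μ θ).ringCon.eq

instance : Star (AZero μ θ) where
  star := Quotient.lift (fun a : Free => mk μ θ (star a)) (fun a b h => by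
    refine mk_eq_mk.2 ?_
    rw [← star_sub]
    exact star_mem_relIdeal μ θ (((relIdeal μ θ).rel_iff a b).1 h))

theorem star_mk (a : Free) : star (mk μ θ a) = mk μ θ (star a) := rfl

instance : StarRing (AZero μ θ) where
  star_involutive x := by
    obtain ⟨a, rfl⟩ := mk_surjective x
    rw [star_mk, star_mk, star_star]
  star_mul x y := by
    obtain ⟨a, rfl⟩ := mk_surjective x
    obtain ⟨b, rfl⟩ := mk_surjective y
    rw [← map_mul, star_mk, star_mk, star_mk, star_mul, map_mul]
  star_add x y := by
    obtain ⟨a, rfl⟩ := mk_surjective x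
    obtain ⟨b, rfl⟩ := mk_surjective y
    rw [← map_add, star_mk, star_mk, star_mk, star_add, map_add]

instance : StarModule ℂ (AZero μ θ) where
  star_smul c x := by
    obtain ⟨a, rfl⟩ := mk_surjective x
    rw [← map_smul, star_mk, star_mk, star_smul, map_smul]

/-- The generator `W` of `A⁰_{μ,θ}`. -/
def W (μ θ : ℝ) : AZero μ θ := mk μ θ fW

/-- The generator `Λ` of `A⁰_{μ,θ}`. -/
def L (μ θ : ℝ) : AZero μ θ := mk μ θ fL

end AZero

/-! ### The noncommutative torus -/

/-- The two generators `U` and `V`. -/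
inductive TGen : Type
  | U : TGen
  | V : TGen

/-- A `C*`-seminorm on the free `*`-algebra on `U, V` which vanishes on the relations
`VU = e^{2πiθ} UV`, `U*U = UU* = 1`, `V*V = VV* = 1`. -/
structure TorusSeminorm (θ : ℝ) where
  /-- The underlying seminorm. -/
  p : Seminorm ℂ (FreeStarAlg TGen)
  mul_le : ∀ a b, p (a * b) ≤ p a * p b
  star_mul_self : ∀ a, p (star a * a) = p a ^ 2
  VU : p (FreeStarAlg.of TGen.V * FreeStarAlg.of TGen.U
    - qPar θ • (FreeStarAlg.of TGen.U * FreeStarAlg.of TGen.V)) = 0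
  UsU : p (star (FreeStarAlg.of TGen.U) * FreeStarAlg.of TGen.U - 1) = 0
  UUs : p (FreeStarAlg.of TGen.U * star (FreeStarAlg.of TGen.U) - 1) = 0
  VsV : p (star (FreeStarAlg.of TGen.V) * FreeStarAlg.of TGen.V - 1) = 0
  VVs : p (FreeStarAlg.of TGen.V * star (FreeStarAlg.of TGen.V) - 1) = 0

namespace TorusSeminorm

variable {θ : ℝ}

instance : Nonempty (TorusSeminorm θ) :=
  ⟨{ p := 0
     mul_le := by simp
     star_mul_self := by simp
     VU := by simp
     UsU := by simp
     UUs := by simp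
     VsV := by simp
     VVs := by simp }⟩

theorem one_le (s : TorusSeminorm θ) : s.p 1 ≤ 1 := by
  have h := s.star_mul_self 1
  rw [star_one, mul_one] at h
  nlinarith [sq_nonneg (s.p 1 - 1), apply_nonneg s.p 1]

theorem star_eq (s : TorusSeminorm θ) (a : FreeStarAlg TGen) : s.p (star a) = s.p a := by
  have key : ∀ b, s.p b ≤ s.p (star b) := fun b => by
    have h1 := s.star_mul_self b
    have h2 := s.mul_le (star b) b
    rcases (apply_nonneg s.p b).eq_or_lt with h0 | h0
    · rw [← h0]; exact apply_nonneg _ _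
    · nlinarith
  refine le_antisymm ?_ (key a)
  simpa using key (star a)

theorem of_le_one (s : TorusSeminorm θ) (g : TGen) : s.p (FreeStarAlg.of g) ≤ 1 := by
  have h : s.p (star (FreeStarAlg.of g) * FreeStarAlg.of g - 1) = 0 := by
    cases g
    · exact s.UsU
    · exact s.VsV
  have h1 : s.p (star (FreeStarAlg.of g) * FreeStarAlg.of g) ≤ 1 := by
    have h2 := map_add_le_add s.p (star (FreeStarAlg.of g) * FreeStarAlg.of g - 1) 1
    rw [sub_add_cancel, h, zero_add] at h2
    exact h2.trans s.one_le
  rw [s.star_mul_self] at h1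
  nlinarith [apply_nonneg s.p (FreeStarAlg.of g)]

theorem bdd (a : FreeStarAlg TGen) : ∃ C : ℝ, ∀ s : TorusSeminorm θ, s.p a ≤ C := by
  induction a using FreeStarAlg.induct with
  | scalar c =>
    refine ⟨‖c‖, fun s => ?_⟩
    rw [Algebra.algebraMap_eq_smul_one, map_smul_eq_mul]
    exact mul_le_of_le_one_right (norm_nonneg c) s.one_le
  | gen l =>
    refine ⟨1, fun s => ?_⟩
    cases l with
    | inl g => exact s.of_le_one g
    | inr g =>
      have e : FreeStarAlg.letter (Sum.inr g) = star (FreeStarAlg.of g) :=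
        (FreeStarAlg.star_letter (Sum.inl g)).symm
      rw [e, s.star_eq]
      exact s.of_le_one g
  | mul a b ha hb =>
    obtain ⟨C, hC⟩ := ha
    obtain ⟨D, hD⟩ := hb
    refine ⟨C * D, fun s => (s.mul_le a b).trans ?_⟩
    exact mul_le_mul (hC s) (hD s) (apply_nonneg _ _) ((apply_nonneg _ _).trans (hC s))
  | add a b ha hb =>
    obtain ⟨C, hC⟩ := ha
    obtain ⟨D, hD⟩ := hb
    exact ⟨C + D, fun s => (map_add_le_add s.p a b).trans (add_le_add (hC s) (hD s))⟩

theorem bddAbove (θ : ℝ) (a : FreeStarAlg TGen) :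
    BddAbove (Set.range fun s : TorusSeminorm θ => s.p a) := by
  obtain ⟨C, hC⟩ := bdd (θ := θ) a
  exact ⟨C, by rintro _ ⟨s, rfl⟩; exact hC s⟩

/-- The universal `C*`-seminorm: the supremum of all admissible `C*`-seminorms. -/
def univ (θ : ℝ) (a : FreeStarAlg TGen) : ℝ := ⨆ s : TorusSeminorm θ, s.p a

theorem le_univ (s : TorusSeminorm θ) (a : FreeStarAlg TGen) : s.p a ≤ univ θ a :=
  le_ciSup (bddAbove θ a) s

theorem univ_le {a : FreeStarAlg TGen} {C : ℝ} (h : ∀ s : TorusSeminorm θ, s.p a ≤ C) :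
    univ θ a ≤ C :=
  ciSup_le h

theorem univ_nonneg (a : FreeStarAlg TGen) : 0 ≤ univ θ a :=
  (apply_nonneg (Classical.arbitrary (TorusSeminorm θ)).p a).trans (le_univ _ a)

/-- The universal seminorm as a ring seminorm. -/
def univRing (θ : ℝ) : RingSeminorm (FreeStarAlg TGen) where
  toFun := univ θ
  map_zero' := by simp [univ]
  add_le' a b := univ_le fun s =>
    (map_add_le_add s.p a b).trans (add_le_add (s.le_univ a) (s.le_univ b))
  neg' a := by simp [univ]
  mul_le' a b := univ_le fun s =>
    (s.mul_le a b).trans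
      (mul_le_mul (s.le_univ a) (s.le_univ b) (apply_nonneg _ _) (univ_nonneg a))

theorem univ_smul_le (c : ℂ) (a : FreeStarAlg TGen) : univ θ (c • a) ≤ ‖c‖ * univ θ a :=
  univ_le fun s => by
    rw [map_smul_eq_mul]
    exact mul_le_mul_of_nonneg_left (s.le_univ a) (norm_nonneg c)

theorem univ_star (a : FreeStarAlg TGen) : univ θ (star a) = univ θ a := by
  simp [univ, star_eq]

theorem univ_mul_self_le (a : FreeStarAlg TGen) :
    univ θ a * univ θ a ≤ univ θ (star a * a) := by
  have h : univ θ a ≤ Real.sqrt (univ θ (star a * a)) := univ_le fun s => by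
    refine Real.le_sqrt_of_sq_le ?_
    rw [← s.star_mul_self]
    exact s.le_univ _
  have h2 := mul_self_le_mul_self (univ_nonneg a) h
  rwa [Real.mul_self_sqrt (univ_nonneg _)] at h2

end TorusSeminorm

/-- The free `*`-algebra on `U, V`, seminormed by the universal `C*`-seminorm. -/
def PreTorus (_θ : ℝ) : Type := FreeStarAlg TGen

namespace PreTorus

variable {θ : ℝ}

instance : SeminormedRing (PreTorus θ) := (TorusSeminorm.univRing θ).toSeminormedRing

instance : StarRing (PreTorus θ) := inferInstanceAs (StarRing (FreeStarAlg TGen))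

instance : NormedAlgebra ℂ (PreTorus θ) where
  toAlgebra := inferInstanceAs (Algebra ℂ (FreeStarAlg TGen))
  norm_smul_le c a := TorusSeminorm.univ_smul_le (θ := θ) c a

instance : StarModule ℂ (PreTorus θ) := inferInstanceAs (StarModule ℂ (FreeStarAlg TGen))

/-- The generators. -/
def of (θ : ℝ) (g : TGen) : PreTorus θ := FreeStarAlg.of g

theorem norm_def (a : PreTorus θ) : ‖a‖ = TorusSeminorm.univ θ a := rfl

instance : NormedStarGroup (PreTorus θ) where
  norm_star_le a := (TorusSeminorm.univ_star (θ := θ) a).le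

theorem norm_mul_self_le (a : PreTorus θ) : ‖a‖ * ‖a‖ ≤ ‖star a * a‖ :=
  TorusSeminorm.univ_mul_self_le (θ := θ) a

theorem uniformContinuous_star : UniformContinuous (star : PreTorus θ → PreTorus θ) :=
  (starNormedAddGroupHom (E := PreTorus θ)).uniformContinuous

end PreTorus

/-- The noncommutative torus `C_θ`: the universal `C*`-algebra generated by `U, V` subject to
`VU = e^{2πiθ} UV`, `U*U = UU* = 1`, `V*V = VV* = 1`, that is the Hausdorff completion of the free
`*`-algebra on `U, V` with respect to the largest `C*`-seminorm vanishing on the relations. -/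
def NCTorus (θ : ℝ) : Type := UniformSpace.Completion (PreTorus θ)

namespace NCTorus

open UniformSpace

variable {θ : ℝ}

instance : NormedRing (NCTorus θ) := inferInstanceAs (NormedRing (Completion (PreTorus θ)))

instance : CompleteSpace (NCTorus θ) := inferInstanceAs (CompleteSpace (Completion (PreTorus θ)))

instance : NormedAlgebra ℂ (NCTorus θ) where
  toAlgebra := inferInstanceAs (Algebra ℂ (Completion (PreTorus θ)))
  norm_smul_le c a := norm_smul_le c (show Completion (PreTorus θ) from a)

/-- The canonical map from the free `*`-algebra. -/
def coe (a : PreTorus θ) : NCTorus θ := (a : Completion (PreTorus θ))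

theorem coe_mul (a b : PreTorus θ) : coe (a * b) = coe a * coe b := Completion.coe_mul a b

theorem coe_add (a b : PreTorus θ) : coe (a + b) = coe a + coe b := Completion.coe_add a b

theorem coe_smul (c : ℂ) (a : PreTorus θ) : coe (c • a) = c • coe a := Completion.coe_smul c a

theorem norm_coe (a : PreTorus θ) : ‖coe a‖ = ‖a‖ := Completion.norm_coe a

theorem denseRange_coe : DenseRange (coe : PreTorus θ → NCTorus θ) := Completion.denseRange_coe

theorem induct {P : NCTorus θ → Prop} (hc : IsClosed {x | P x}) (h : ∀ a, P (coe a))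
    (x : NCTorus θ) : P x :=
  Completion.induction_on (p := P) x hc h

theorem induct₂ {P : NCTorus θ → NCTorus θ → Prop}
    (hc : IsClosed {x : NCTorus θ × NCTorus θ | P x.1 x.2}) (h : ∀ a b, P (coe a) (coe b))
    (x y : NCTorus θ) : P x y :=
  Completion.induction_on₂ (p := P) x y hc h

instance : Star (NCTorus θ) where
  star := Completion.map (star : PreTorus θ → PreTorus θ)

theorem star_coe (a : PreTorus θ) : star (coe a) = coe (star a) :=
  Completion.map_coe PreTorus.uniformContinuous_star a

theorem continuous_star' : Continuous (star : NCTorus θ → NCTorus θ) := Completion.continuous_map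

instance : StarRing (NCTorus θ) where
  star_involutive x := by
    induction x using induct with
    | hc => exact isClosed_eq (continuous_star'.comp continuous_star') continuous_id
    | h a => rw [star_coe, star_coe, star_star]
  star_mul x y := by
    induction x, y using induct₂ with
    | hc =>
      exact isClosed_eq (continuous_star'.comp (continuous_fst.mul continuous_snd))
        ((continuous_star'.comp continuous_snd).mul (continuous_star'.comp continuous_fst))
    | h a b => rw [← coe_mul, star_coe, star_coe, star_coe, star_mul, coe_mul]
  star_add x y := by
    induction x, y using induct₂ with
    | hc =>
      exact isClosed_eq (continuous_star'.comp (continuous_fst.add continuous_snd))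
        ((continuous_star'.comp continuous_fst).add (continuous_star'.comp continuous_snd))
    | h a b => rw [← coe_add, star_coe, star_coe, star_coe, star_add, coe_add]

instance : StarModule ℂ (NCTorus θ) where
  star_smul c x := by
    induction x using induct with
    | hc =>
      exact isClosed_eq (continuous_star'.comp (continuous_const_smul c))
        (continuous_star'.const_smul (star c))
    | h a => rw [← coe_smul, star_coe, star_coe, star_smul, coe_smul]

instance : CStarRing (NCTorus θ) where
  norm_mul_self_le x := by
    induction x using induct with
    | hc =>
      exact isClosed_le (continuous_norm.mul continuous_norm)
        (continuous_norm.comp (continuous_star'.mul continuous_id))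
    | h a => rw [star_coe, ← coe_mul, norm_coe, norm_coe]; exact PreTorus.norm_mul_self_le a

instance : CStarAlgebra (NCTorus θ) where

/-- The order of a `C*`-algebra: `a ≤ b` iff `b - a` is self-adjoint with nonnegative spectrum. -/
instance : PartialOrder (NCTorus θ) := CStarAlgebra.spectralOrder _

instance : StarOrderedRing (NCTorus θ) := CStarAlgebra.spectralOrderedRing _

/-- The generator `U`. -/
def U (θ : ℝ) : NCTorus θ := coe (PreTorus.of θ TGen.U)

/-- The generator `V`. -/
def V (θ : ℝ) : NCTorus θ := coe (PreTorus.of θ TGen.V)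

/-- The element `R = μ 1 + z U + z̄ U*`. -/
def R (μ θ : ℝ) : NCTorus θ := (μ : ℂ) • 1 + zPar θ • U θ + star (zPar θ) • star (U θ)

/-! The relations hold in `C_θ`, and `C_θ` has the universal property (in every universe). -/

theorem coe_eq_of_norm {a b : PreTorus θ} (h : ‖a - b‖ = 0) : coe a = coe b := by
  rw [← sub_eq_zero, ← norm_eq_zero, ← h, ← norm_coe (a - b)]
  exact congrArg norm (Completion.coe_sub a b).symm

theorem V_mul_U (θ : ℝ) : V θ * U θ = qPar θ • (U θ * V θ) := by
  unfold U V
  rw [← coe_mul, ← coe_mul, ← coe_smul]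
  exact coe_eq_of_norm (le_antisymm (TorusSeminorm.univ_le fun s => s.VU.le) (norm_nonneg _))

theorem star_U_mul_U (θ : ℝ) : star (U θ) * U θ = 1 := by
  unfold U
  rw [star_coe, ← coe_mul]
  exact coe_eq_of_norm (le_antisymm (TorusSeminorm.univ_le fun s => s.UsU.le) (norm_nonneg _))

theorem U_mul_star_U (θ : ℝ) : U θ * star (U θ) = 1 := by
  unfold U
  rw [star_coe, ← coe_mul]
  exact coe_eq_of_norm (le_antisymm (TorusSeminorm.univ_le fun s => s.UUs.le) (norm_nonneg _))

theorem star_V_mul_V (θ : ℝ) : star (V θ) * V θ = 1 := by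
  unfold V
  rw [star_coe, ← coe_mul]
  exact coe_eq_of_norm (le_antisymm (TorusSeminorm.univ_le fun s => s.VsV.le) (norm_nonneg _))

theorem V_mul_star_V (θ : ℝ) : V θ * star (V θ) = 1 := by
  unfold V
  rw [star_coe, ← coe_mul]
  exact coe_eq_of_norm (le_antisymm (TorusSeminorm.univ_le fun s => s.VVs.le) (norm_nonneg _))

/-- The seminorm pulled back from a representation of the relations in a `C*`-algebra. -/
def pullback {B : Type*} [CStarAlgebra B] (f : TGen → B)
    (h : f .V * f .U = qPar θ • (f .U * f .V))
    (h1 : star (f .U) * f .U = 1) (h2 : f .U * star (f .U) = 1)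
    (h3 : star (f .V) * f .V = 1) (h4 : f .V * star (f .V) = 1) : TorusSeminorm θ where
  p := (normSeminorm ℂ B).comp (FreeStarAlg.lift f).toAlgHom.toLinearMap
  mul_le a b := by simpa using norm_mul_le (FreeStarAlg.lift f a) (FreeStarAlg.lift f b)
  star_mul_self a := by
    simpa [map_star, sq] using CStarRing.norm_star_mul_self (x := FreeStarAlg.lift f a)
  VU := by simp [h]
  UsU := by simp [h1, map_star]
  UUs := by simp [h2, map_star]
  VsV := by simp [h3, map_star]
  VVs := by simp [h4, map_star]

theorem exists_lift {B : Type*} [CStarAlgebra B] (f : TGen → B)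
    (h : f .V * f .U = qPar θ • (f .U * f .V))
    (h1 : star (f .U) * f .U = 1) (h2 : f .U * star (f .U) = 1)
    (h3 : star (f .V) * f .V = 1) (h4 : f .V * star (f .V) = 1) :
    ∃ π : NCTorus θ →⋆ₐ[ℂ] B, π (U θ) = f .U ∧ π (V θ) = f .V := by
  let g : PreTorus θ →⋆ₐ[ℂ] B := FreeStarAlg.lift f
  have hb : ∀ a, ‖g a‖ ≤ ‖a‖ := fun a => (pullback f h h1 h2 h3 h4).le_univ a
  have hg : Continuous g.toAlgHom.toRingHom :=
    AddMonoidHomClass.continuous_of_bound g 1 (by simpa using hb)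
  let π : NCTorus θ →+* B := Completion.extensionHom g.toAlgHom.toRingHom hg
  have hc : ∀ a : PreTorus θ, π (coe a) = g a := fun a => Completion.extensionHom_coe _ hg a
  have hcont : Continuous π := Completion.continuous_extension
  refine ⟨{ π with commutes' := fun c => ?_, map_star' := fun x => ?_ }, ?_, ?_⟩
  · exact (hc (algebraMap ℂ _ c)).trans (AlgHomClass.commutes g c)
  · change π (star x) = star (π x)
    induction x using induct with
    | hc => exact isClosed_eq (hcont.comp continuous_star') (continuous_star.comp hcont)
    | h a => rw [star_coe, hc, hc, map_star]
  · exact (hc _).trans (FreeStarAlg.lift_of f _)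
  · exact (hc _).trans (FreeStarAlg.lift_of f _)

end NCTorus

end

/-!
The relations of `A⁰` allow every element to be written in normal order, as a linear combination of
the monomials `Λⁿ Wᵏ` with `n k : ℤ`, where `Wᵏ` means `(W*)⁻ᵏ` for `k < 0`: `Λ` is a unit commuting
with `W` and `W*` up to scalars, and `WW*`, `W*W` are polynomials in `Λ` and `Λ*`
(`AZero.span_monomial`). Injectivity of `φ` therefore follows from linear independence of the images
`φ(Λⁿ Wᵏ) = Uⁿ Fₖ` (`linearIndependent_map_monomial`), where `Fₖ` is the corresponding power of
`√R V` or of its adjoint.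

The torus acts on `C_θ` by the automorphisms `U ↦ aU`, `V ↦ bV` (`NCTorus.gauge`). Those with `a = 1`
fix `R`, hence `√R` by uniqueness of positive square roots, and so multiply `Uⁿ Fₖ` by `bᵏ`. As the
characters `b ↦ bᵏ` of the circle are linearly independent, a vanishing combination of the `Uⁿ Fₖ`
vanishes for each `k` separately (`sum_weight_eq_zero`). The factor `Fₖ` is invertible because
`R` is, and cancels; the action on `U` then separates the powers `Uⁿ`, which are nonzero because
`C_θ` has a nonzero representation on `ℓ²(ℤ)`. This route needs neither a trace on `C_θ` nor the
conditional expectation onto the subalgebra generated by `U`.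

Strict positivity of `R` is the estimate `‖zU + z̄U*‖ ≤ 2|z| = 1 / |cos πθ| < μ`, and the relations
for `√R V` and `U` reduce to `V* U V = q⁻¹ U` and `q⁻¹ z = -z̄` (`star_qPar_mul_zPar`).
-/

noncomputable section

/-! ### Separating weights under a circle action -/

theorem Circle.zpow_exponent_injective :
    Function.Injective fun (k : ℤ) (a : Circle) => ((a ^ k : Circle) : ℂ) := by
  intro k m h
  by_contra hne
  have hd : ((k - m : ℤ) : ℝ) ≠ 0 := by exact_mod_cast sub_ne_zero.2 hne
  -- the angle `π / (k - m)` separates the weights `k` and `m`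
  have h1 : Circle.exp (Real.pi / ((k - m : ℤ) : ℝ)) ^ (k - m) = 1 := by
    rw [zpow_sub, mul_inv_eq_one]
    exact Circle.ext (congrFun h _)
  rw [← Circle.exp_zsmul, zsmul_eq_mul, mul_div_cancel₀ _ hd] at h1
  have h2 := congrArg (fun a : Circle => (a : ℂ)) h1
  simp only [Circle.coe_exp, Complex.exp_pi_mul_I, Circle.coe_one] at h2
  norm_num at h2

theorem linearIndependent_circle_zpow :
    LinearIndependent ℂ fun (k : ℤ) (a : Circle) => ((a ^ k : Circle) : ℂ) := by
  have h := linearIndependent_monoidHom Circle ℂ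
  exact h.comp (fun k : ℤ => Circle.coeHom.comp (zpowGroupHom k))
    fun k m hkm => Circle.zpow_exponent_injective (congrArg (fun f : Circle →* ℂ => ⇑f) hkm)

/-- If the circle acts by linear maps and `v i` has weight `d i`, then a vanishing linear
combination of the `v i` vanishes in each weight: the characters of the circle are linearly
independent. -/
theorem sum_weight_eq_zero {M ι : Type*} [AddCommGroup M] [Module ℂ M] (α : Circle → M →ₗ[ℂ] M)
    {v : ι → M} {d : ι → ℤ} (hα : ∀ a i, α a (v i) = ((a ^ d i : Circle) : ℂ) • v i)
    {s : Finset ι} {g : ι → ℂ} (h : ∑ i ∈ s, g i • v i = 0) (k : ℤ) :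
    ∑ i ∈ s with d i = k, g i • v i = 0 := by
  classical
  rw [← Module.forall_dual_apply_eq_zero_iff ℂ]
  intro f
  by_cases hk : k ∈ s.image d
  · have key := linearIndependent_iff'.1 linearIndependent_circle_zpow (s.image d)
      (fun k => f (∑ i ∈ s with d i = k, g i • v i)) ?_ k hk
    · exact key
    ext a
    have h1 := congrArg (fun x => f (α a x)) h
    simp only [map_sum, map_smul, hα, map_zero, smul_eq_mul] at h1
    simp only [map_sum, map_smul, Finset.sum_apply, Pi.smul_apply, smul_eq_mul, Pi.zero_apply]
    rw [← h1, ← Finset.sum_fiberwise_of_maps_to (t := s.image d) (g := d)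
      fun i hi => Finset.mem_image_of_mem d hi]
    refine Finset.sum_congr rfl fun m _ => ?_
    rw [Finset.sum_mul]
    refine Finset.sum_congr rfl fun i hi => ?_
    rw [(Finset.mem_filter.1 hi).2]
    ring
  · rw [Finset.filter_eq_empty_iff.2 fun i hi hik => hk (Finset.mem_image.2 ⟨i, hi, hik⟩)]
    simp

/-! ### Powers with integer exponents of an element and its adjoint -/

/-- `w ^ k` for `k ≥ 0` and `(w*) ^ (-k)` for `k < 0`. For `w` unitary this is the integer power,
but no invertibility is assumed. -/
def starZPow {A : Type*} [Monoid A] [Star A] (w : A) : ℤ → A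
  | Int.ofNat n => w ^ n
  | Int.negSucc n => star w ^ (n + 1)

section starZPow

variable {A B : Type*} [Ring A] [StarRing A] [Ring B] [StarRing B]

theorem map_starZPow [Algebra ℂ A] [Algebra ℂ B] (f : A →⋆ₐ[ℂ] B) (w : A) (k : ℤ) : f (starZPow w k) = starZPow (f w) k := by
  cases k <;> simp [starZPow, map_star]

theorem isUnit_starZPow {w : A} (hw : IsUnit w) (k : ℤ) : IsUnit (starZPow w k) := by
  cases k with
  | ofNat n => exact hw.pow n
  | negSucc n => exact hw.star.pow (n + 1)

theorem starZPow_circle_smul [Algebra ℂ A] [StarModule ℂ A] (a : Circle) (w : A) (k : ℤ) :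
    starZPow ((a : ℂ) • w) k = ((a ^ k : Circle) : ℂ) • starZPow w k := by
  cases k with
  | ofNat n => simp [starZPow, smul_pow]
  | negSucc n =>
    simp only [starZPow, star_smul, smul_pow, zpow_negSucc, Circle.coe_inv_eq_conj, Circle.coe_pow,
      map_pow]
    rfl

end starZPow

/-! ### The constants -/

theorem qPar_eq (θ : ℝ) : qPar θ = Complex.exp ((2 * Real.pi * θ : ℝ) * Complex.I) := by
  rw [qPar]; congr 1; push_cast; ring

theorem zPar_eq (θ : ℝ) : zPar θ = Complex.exp ((Real.pi * θ : ℝ) * Complex.I)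
    / (2 * Complex.I * (Real.cos (Real.pi * θ) : ℝ)) := by
  rw [zPar, Complex.ofReal_cos, Complex.ofReal_mul]
  congr 2; ring

/-- This identity makes the two relations for `WW*` and `W*W` compatible with
`W = √R V`, as `V* U V = q⁻¹ U`. -/
theorem star_qPar_mul_zPar (θ : ℝ) : star (qPar θ) * zPar θ = -star (zPar θ) := by
  simp only [qPar_eq, zPar_eq, Complex.star_def, map_div₀, ← Complex.exp_conj, map_mul,
    Complex.conj_ofReal, Complex.conj_I, map_ofNat]
  rw [mul_div_assoc', ← Complex.exp_add, mul_neg, mul_neg, mul_neg, neg_mul, div_neg, neg_neg]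
  congr 2; push_cast; ring

/-! ### Symmetries of the noncommutative torus -/

namespace NCTorus

variable {μ θ : ℝ}

/-- The generator `U` as a unit. -/
def unitU (θ : ℝ) : (NCTorus θ)ˣ := ⟨U θ, star (U θ), U_mul_star_U θ, star_U_mul_U θ⟩

theorem exists_gauge (θ : ℝ) (a b : Circle) :
    ∃ α : NCTorus θ →⋆ₐ[ℂ] NCTorus θ, α (U θ) = (a : ℂ) • U θ ∧ α (V θ) = (b : ℂ) • V θ := by
  have hc : ∀ c : Circle, (starRingEnd ℂ) (c : ℂ) * c = 1 := fun c => by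
    rw [← Circle.coe_inv_eq_conj, ← Circle.coe_mul, inv_mul_cancel, Circle.coe_one]
  have hc' : ∀ c : Circle, (c : ℂ) * (starRingEnd ℂ) c = 1 := fun c => by rw [mul_comm, hc]
  refine exists_lift (θ := θ) (fun g => match g with
    | .U => (a : ℂ) • U θ
    | .V => (b : ℂ) • V θ) ?_ ?_ ?_ ?_ ?_
  · simp only [smul_mul_smul_comm, V_mul_U, smul_smul]
    congr 1; ring
  all_goals
    simp [smul_smul, hc, hc', star_U_mul_U, U_mul_star_U, star_V_mul_V, V_mul_star_V]

/-- The gauge action of the `2`-torus: `gauge θ a b` is `U ↦ aU`, `V ↦ bV`. -/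
def gauge (θ : ℝ) (a b : Circle) : NCTorus θ →⋆ₐ[ℂ] NCTorus θ := (exists_gauge θ a b).choose

theorem gauge_U (a b : Circle) : gauge θ a b (U θ) = (a : ℂ) • U θ :=
  (exists_gauge θ a b).choose_spec.1

theorem gauge_V (a b : Circle) : gauge θ a b (V θ) = (b : ℂ) • V θ :=
  (exists_gauge θ a b).choose_spec.2

theorem gauge_unitU_zpow (a b : Circle) (n : ℤ) :
    gauge θ a b ((unitU θ ^ n : (NCTorus θ)ˣ) : NCTorus θ)
      = ((a ^ n : Circle) : ℂ) • ((unitU θ ^ n : (NCTorus θ)ˣ) : NCTorus θ) := by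
  have h : ∀ n : ℤ, ((unitU θ ^ n : (NCTorus θ)ˣ) : NCTorus θ) = starZPow (U θ) n := by
    rintro (n | n)
    · simp [starZPow, unitU]
    · rw [zpow_negSucc, ← inv_pow]
      simp [starZPow, unitU]
  rw [h, map_starZPow, gauge_U, starZPow_circle_smul]

/-! ### A nonzero representation of the noncommutative torus -/

/-- A diagonal unitary with eigenvalues `q⁻ⁿ` and the bilateral shift on `ℓ²(ℤ)` satisfy the
relations, so `C_θ` is not the zero algebra. -/
instance : Nontrivial (NCTorus θ) := by
  let H := lp (fun _ : ℤ => ℂ) 2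
  let e : HilbertBasis ℤ ℂ H := default
  -- an orthonormal family spanning the same lines as `e` is the image of `e` under a unitary
  have hU : ∀ (c : ℤ → Circle) (σ : ℤ ≃ ℤ), ∃ u : unitary (H →L[ℂ] H),
      ∀ n, (u : H →L[ℂ] H) (e n) = (c n : ℂ) • e (σ n) := by
    intro c σ
    have ho : Orthonormal ℂ fun n => (c n : ℂ) • e (σ n) := by
      refine ⟨fun n => ?_, fun m n hmn => ?_⟩
      · rw [norm_smul, Circle.norm_coe, e.orthonormal.1, one_mul]
      · change inner ℂ ((c m : ℂ) • e (σ m)) ((c n : ℂ) • e (σ n)) = 0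
        rw [inner_smul_left, inner_smul_right, e.orthonormal.2 (σ.injective.ne hmn)]
        simp
    have hs : (⊤ : Submodule ℂ H)
        ≤ (Submodule.span ℂ (Set.range fun n => (c n : ℂ) • e (σ n))).topologicalClosure := by
      rw [← e.dense_span]
      refine Submodule.topologicalClosure_mono (Submodule.span_le.2 ?_)
      rintro _ ⟨n, rfl⟩
      have h := Submodule.smul_mem _ ((c (σ.symm n) : ℂ)⁻¹)
        (Submodule.subset_span (R := ℂ) (Set.mem_range_self (f := fun n => (c n : ℂ) • e (σ n))
          (σ.symm n)))
      simpa [smul_smul] using h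
    refine ⟨Unitary.linearIsometryEquiv.symm (e.repr.trans (HilbertBasis.mk ho hs).repr.symm),
      fun n => ?_⟩
    change (HilbertBasis.mk ho hs).repr.symm (e.repr (e n)) = _
    rw [e.repr_self, HilbertBasis.repr_symm_single, HilbertBasis.coe_mk]
  let t : Circle := Circle.exp (2 * Real.pi * θ)
  have ht : qPar θ = t := by
    rw [qPar_eq, Circle.coe_exp]
  obtain ⟨u, hu⟩ := hU (fun n => t ^ (-n)) (Equiv.refl ℤ)
  obtain ⟨v, hv⟩ := hU (fun _ => 1) (Equiv.addRight 1)
  obtain ⟨π, -, -⟩ := exists_lift (θ := θ) (B := H →L[ℂ] H)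
    (fun g => match g with | .U => u | .V => v) (by
      refine ContinuousLinearMap.ext_on (s := Set.range e) ?_ ?_
      · exact Submodule.dense_iff_topologicalClosure_eq_top.2 e.dense_span
      · rintro _ ⟨n, rfl⟩
        change (v : H →L[ℂ] H) ((u : H →L[ℂ] H) (e n))
          = qPar θ • (u : H →L[ℂ] H) ((v : H →L[ℂ] H) (e n))
        rw [hu, hv, map_smul, map_smul, Equiv.refl_apply, hv, hu, ht, Equiv.refl_apply,
          Equiv.coe_addRight, smul_smul, smul_smul, smul_smul, ← Circle.coe_mul,
          ← Circle.coe_mul, ← Circle.coe_mul, mul_one, mul_one, ← zpow_one_add]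
        congr 3; ring)
    (Unitary.coe_star_mul_self u) (Unitary.coe_mul_star_self u)
    (Unitary.coe_star_mul_self v) (Unitary.coe_mul_star_self v)
  have : Nontrivial (H →L[ℂ] H) := by
    refine ⟨1, 0, fun h => ?_⟩
    have h1 := congrArg (fun T : H →L[ℂ] H => ‖T (e 0)‖) h
    simp [e.orthonormal.1] at h1
  exact π.toRingHom.domain_nontrivial

/-- The powers of `U` are linearly independent: they have distinct weights. -/
theorem linearIndependent_unitU_zpow :
    LinearIndependent ℂ fun n : ℤ => ((unitU θ ^ n : (NCTorus θ)ˣ) : NCTorus θ) := by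
  refine linearIndependent_iff'.2 fun s g h n hn => ?_
  have h1 := sum_weight_eq_zero (fun a => (gauge θ a 1).toAlgHom.toLinearMap) (d := id)
    (fun a n => gauge_unitU_zpow a 1 n) h n
  rw [Finset.sum_filter] at h1
  simp only [id, Finset.sum_ite_eq', hn, if_true] at h1
  exact (smul_eq_zero.1 h1).resolve_right (Units.ne_zero _)

/-! ### The element `R` and its square root -/

theorem norm_U_le : ‖U θ‖ ≤ 1 := by
  have h := CStarRing.norm_star_mul_self (x := U θ)
  rw [star_U_mul_U, norm_one] at h
  nlinarith [norm_nonneg (U θ)]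

theorem norm_zPar (θ : ℝ) : ‖zPar θ‖ = 1 / (2 * |Real.cos (Real.pi * θ)|) := by
  rw [zPar_eq, norm_div, Complex.norm_exp_ofReal_mul_I, norm_mul, norm_mul, Complex.norm_I,
    Complex.norm_real, Real.norm_eq_abs, Complex.norm_ofNat, mul_one]

/-- The non-scalar part of `R` has norm at most `2|z| = 1 / |cos πθ| < μ`. -/
theorem isStrictlyPositive_R (hμ : 0 < μ) (hμθ : 1 < |μ * Real.cos (Real.pi * θ)|) :
    IsStrictlyPositive (R μ θ) := by
  set T : NCTorus θ := zPar θ • U θ + star (zPar θ) • star (U θ) with hT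
  have hsa : IsSelfAdjoint T := by
    rw [IsSelfAdjoint, hT, star_add, star_smul, star_smul, star_star, star_star, add_comm]
  have hn : ‖T‖ ≤ 2 * ‖zPar θ‖ := by
    refine (norm_add_le _ _).trans ?_
    rw [norm_smul, norm_smul, norm_star, norm_star]
    nlinarith [norm_U_le (θ := θ), norm_nonneg (zPar θ)]
  have hlt : 2 * ‖zPar θ‖ < μ := by
    rw [abs_mul, abs_of_pos hμ] at hμθ
    have hc : 0 < |Real.cos (Real.pi * θ)| := by
      by_contra! hc
      nlinarith
    rw [norm_zPar, ← div_div, mul_div_assoc', mul_div_cancel₀ _ two_ne_zero, div_lt_iff₀ hc]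
    exact hμθ
  have hR : R μ θ = algebraMap ℝ (NCTorus θ) μ + T := by
    rw [R, hT, add_assoc, Algebra.algebraMap_eq_smul_one]
    rfl
  refine (isStrictlyPositive_algebraMap (sub_pos.2 (hn.trans_lt hlt))).of_le (A := NCTorus θ) ?_
  rw [hR, map_sub, sub_eq_add_neg]
  gcongr
  exact hsa.neg_algebraMap_norm_le_self

theorem commute_sqrt_R_U (μ θ : ℝ) : Commute (CFC.sqrt (R μ θ)) (U θ) := by
  refine Commute.cfcₙ_nnreal ?_ _
  have h : Commute (star (U θ)) (U θ) := (star_U_mul_U θ).trans (U_mul_star_U θ).symm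
  exact (((Commute.one_left _).smul_left _).add_left ((Commute.refl _).smul_left _)).add_left
    (h.smul_left _)

theorem gauge_sqrt_R (hR : 0 ≤ R μ θ) (b : Circle) :
    gauge θ 1 b (CFC.sqrt (R μ θ)) = CFC.sqrt (R μ θ) := by
  refine (CFC.sqrt_unique ?_ (map_nonneg _ (CFC.sqrt_nonneg _))).symm
  rw [← map_mul, CFC.sqrt_mul_sqrt_self _ hR]
  simp only [R, map_add, map_smul, map_one, map_star, gauge_U, Circle.coe_one, one_smul]

theorem star_V_mul_U (θ : ℝ) : star (V θ) * U θ = star (qPar θ) • (U θ * star (V θ)) := by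
  have h : U θ * star (V θ) = qPar θ • (star (V θ) * U θ) := by
    calc U θ * star (V θ) = star (V θ) * (V θ * U θ) * star (V θ) := by
          rw [← mul_assoc (star (V θ)), star_V_mul_V, one_mul]
      _ = _ := by
          rw [V_mul_U, mul_smul_comm, smul_mul_assoc, mul_assoc, mul_assoc, V_mul_star_V, mul_one]
  rw [h, smul_smul, mul_comm, qPar_mul_star, one_smul]

theorem star_V_mul_R_mul_V (μ θ : ℝ) : star (V θ) * R μ θ * V θ = (μ : ℂ) • 1
    + (star (qPar θ) * zPar θ) • U θ + (qPar θ * star (zPar θ)) • star (U θ) := by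
  have h1 : star (V θ) * U θ * V θ = star (qPar θ) • U θ := by
    rw [star_V_mul_U, smul_mul_assoc, mul_assoc, star_V_mul_V, mul_one]
  have h2 : star (V θ) * star (U θ) * V θ = qPar θ • star (U θ) := by
    simpa [mul_assoc] using congrArg star h1
  simp only [R, mul_add, add_mul, mul_smul_comm, smul_mul_assoc, mul_one, star_V_mul_V, h1, h2,
    smul_smul]
  congr 2
  · rw [mul_comm]
  · rw [mul_comm]

end NCTorus

/-! ### The algebra `A⁰` -/

namespace AZero

variable {μ θ : ℝ}

theorem mk_eq_zero_of_rel {r : Free} (h : Rel μ θ r) : mk μ θ r = 0 := by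
  rw [← map_zero (mk μ θ), mk_eq_mk, sub_zero]
  exact TwoSidedIdeal.subset_span h

/-- The existence part of the universal property of `A⁰`. -/
theorem exists_lift {B : Type*} [Ring B] [StarRing B] [Algebra ℂ B] [StarModule ℂ B] (g : AGen → B)
    (h : ∀ r, Rel μ θ r → FreeStarAlg.lift g r = 0) :
    ∃ φ : AZero μ θ →⋆ₐ[ℂ] B, φ (W μ θ) = g .W ∧ φ (L μ θ) = g .L := by
  let f : Free →⋆ₐ[ℂ] B := FreeStarAlg.lift g
  have hle : relIdeal μ θ ≤ TwoSidedIdeal.ker f.toAlgHom.toRingHom :=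
    TwoSidedIdeal.span_le.2 fun r hr => (TwoSidedIdeal.mem_ker _).2 (h r hr)
  have hk : (relIdeal μ θ).ringCon ≤ RingCon.ker f.toAlgHom.toRingHom := fun a b hab => by
    have h1 := (TwoSidedIdeal.mem_ker _).1 (hle (((relIdeal μ θ).rel_iff a b).1 hab))
    rw [map_sub, sub_eq_zero] at h1
    exact h1
  let φ : AZero μ θ →ₐ[ℂ] B := RingCon.liftₐ (relIdeal μ θ).ringCon f.toAlgHom hk
  have hφ : ∀ a, φ (mk μ θ a) = f a := fun a => rfl
  refine ⟨{ φ with map_star' := fun x => ?_ }, ?_, ?_⟩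
  · obtain ⟨a, rfl⟩ := mk_surjective x
    change φ (star (mk μ θ a)) = star (φ (mk μ θ a))
    rw [star_mk, hφ, hφ, map_star]
  · exact (hφ _).trans (FreeStarAlg.lift_of _ AGen.W)
  · exact (hφ _).trans (FreeStarAlg.lift_of _ AGen.L)

theorem hom_ext {B : Type*} [Ring B] [StarRing B] [Algebra ℂ B] {φ ψ : AZero μ θ →⋆ₐ[ℂ] B}
    (hW : φ (W μ θ) = ψ (W μ θ)) (hL : φ (L μ θ) = ψ (L μ θ)) : φ = ψ := by
  let m : Free →⋆ₐ[ℂ] AZero μ θ := { mk μ θ with map_star' := fun a => (star_mk a).symm }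
  have h : φ.comp m = ψ.comp m := FreeStarAlg.hom_ext fun g => by
    cases g
    · exact hW
    · exact hL
  ext x
  obtain ⟨a, rfl⟩ := mk_surjective x
  exact DFunLike.congr_fun h a

theorem W_mul_L : W μ θ * L μ θ = qPar θ • (L μ θ * W μ θ) := by
  have h := mk_eq_zero_of_rel (Rel.WL (μ := μ) (θ := θ))
  rwa [map_sub, map_smul, map_mul, map_mul, sub_eq_zero] at h

theorem star_W_mul_L : star (W μ θ) * L μ θ = star (qPar θ) • (L μ θ * star (W μ θ)) := by
  have h := mk_eq_zero_of_rel (Rel.WsL (μ := μ) (θ := θ))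
  rwa [map_sub, map_smul, map_mul, map_mul, sub_eq_zero] at h

theorem star_W_mul_star_L :
    star (W μ θ) * star (L μ θ) = qPar θ • (star (L μ θ) * star (W μ θ)) := by
  have h := mk_eq_zero_of_rel (Rel.WsLs (μ := μ) (θ := θ))
  rwa [map_sub, map_smul, map_mul, map_mul, sub_eq_zero] at h

theorem W_mul_star_L : W μ θ * star (L μ θ) = star (qPar θ) • (star (L μ θ) * W μ θ) := by
  have h := mk_eq_zero_of_rel (Rel.WLs (μ := μ) (θ := θ))
  rwa [map_sub, map_smul, map_mul, map_mul, sub_eq_zero] at h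

theorem star_L_mul_L : star (L μ θ) * L μ θ = 1 := by
  have h := mk_eq_zero_of_rel (Rel.LsL (μ := μ) (θ := θ))
  rwa [map_sub, map_one, map_mul, sub_eq_zero] at h

theorem L_mul_star_L : L μ θ * star (L μ θ) = 1 := by
  have h := mk_eq_zero_of_rel (Rel.LLs (μ := μ) (θ := θ))
  rwa [map_sub, map_one, map_mul, sub_eq_zero] at h

theorem W_mul_star_W : W μ θ * star (W μ θ)
    = zPar θ • L μ θ + star (zPar θ) • star (L μ θ) + (μ : ℂ) • 1 := by
  have h := mk_eq_zero_of_rel (Rel.WWs (μ := μ) (θ := θ))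
  simp only [map_sub, map_add, map_smul, map_one, map_mul] at h
  exact sub_eq_zero.1 h

theorem star_W_mul_W : star (W μ θ) * W μ θ
    = -(star (zPar θ) • L μ θ) - zPar θ • star (L μ θ) + (μ : ℂ) • 1 := by
  have h := mk_eq_zero_of_rel (Rel.WsW (μ := μ) (θ := θ))
  simp only [map_sub, map_add, map_neg, map_smul, map_one, map_mul] at h
  exact sub_eq_zero.1 h

/-- The generator `Λ` as a unit. -/
def unitL (μ θ : ℝ) : (AZero μ θ)ˣ := ⟨L μ θ, star (L μ θ), L_mul_star_L, star_L_mul_L⟩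

/-- The normally ordered monomial `Λⁿ Wᵏ`, where `Wᵏ` stands for `(W*)⁻ᵏ` if `k < 0`. -/
def monomial (μ θ : ℝ) (p : ℤ × ℤ) : AZero μ θ :=
  ((unitL μ θ ^ p.1 : (AZero μ θ)ˣ) : AZero μ θ) * starZPow (W μ θ) p.2

theorem L_mul_mem {x : AZero μ θ} (hx : x ∈ Submodule.span ℂ (Set.range (monomial μ θ))) :
    L μ θ * x ∈ Submodule.span ℂ (Set.range (monomial μ θ)) := by
  induction hx using Submodule.span_induction with
  | mem x hx =>
    obtain ⟨⟨n, k⟩, rfl⟩ := hx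
    refine Submodule.subset_span ⟨(1 + n, k), ?_⟩
    rw [monomial, monomial, zpow_add, zpow_one, Units.val_mul, mul_assoc]
    rfl
  | zero => simp
  | add x y _ _ hx hy => rw [mul_add]; exact add_mem hx hy
  | smul c x _ hx => rw [mul_smul_comm]; exact Submodule.smul_mem _ _ hx

theorem star_L_mul_mem {x : AZero μ θ} (hx : x ∈ Submodule.span ℂ (Set.range (monomial μ θ))) :
    star (L μ θ) * x ∈ Submodule.span ℂ (Set.range (monomial μ θ)) := by
  induction hx using Submodule.span_induction with
  | mem x hx =>
    obtain ⟨⟨n, k⟩, rfl⟩ := hx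
    refine Submodule.subset_span ⟨(-1 + n, k), ?_⟩
    rw [monomial, monomial, zpow_add, zpow_neg_one, Units.val_mul, mul_assoc]
    rfl
  | zero => simp
  | add x y _ _ hx hy => rw [mul_add]; exact add_mem hx hy
  | smul c x _ hx => rw [mul_smul_comm]; exact Submodule.smul_mem _ _ hx

/-- Left multiplication by an element commuting with `Λ` and `Λ*` up to scalars preserves the span
of the monomials as soon as it maps the `Wᵏ` into it. -/
theorem mul_mem_of_commute_up_to_scalar {a : AZero μ θ} {c d : ℂ}
    (hL : a * L μ θ = c • (L μ θ * a)) (hLs : a * star (L μ θ) = d • (star (L μ θ) * a))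
    (ha : ∀ k, a * starZPow (W μ θ) k ∈ Submodule.span ℂ (Set.range (monomial μ θ)))
    {x : AZero μ θ} (hx : x ∈ Submodule.span ℂ (Set.range (monomial μ θ))) :
    a * x ∈ Submodule.span ℂ (Set.range (monomial μ θ)) := by
  induction hx using Submodule.span_induction with
  | mem x hx =>
    obtain ⟨⟨n, k⟩, rfl⟩ := hx
    simp only [monomial]
    induction n with
    | zero => simpa using ha k
    | succ n ih =>
      rw [add_comm, zpow_add, zpow_one, Units.val_mul, mul_assoc, ← mul_assoc a]
      change a * L μ θ * _ ∈ _
      rw [hL, smul_mul_assoc, mul_assoc]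
      exact Submodule.smul_mem _ _ (L_mul_mem ih)
    | pred n ih =>
      rw [sub_eq_neg_add, zpow_add, zpow_neg_one, Units.val_mul, mul_assoc, ← mul_assoc a]
      change a * star (L μ θ) * _ ∈ _
      rw [hLs, smul_mul_assoc, mul_assoc]
      exact Submodule.smul_mem _ _ (star_L_mul_mem ih)
  | zero => simp
  | add x y _ _ hx hy => rw [mul_add]; exact add_mem hx hy
  | smul c x _ hx => rw [mul_smul_comm]; exact Submodule.smul_mem _ _ hx

theorem starZPow_W_mem (k : ℤ) :
    starZPow (W μ θ) k ∈ Submodule.span ℂ (Set.range (monomial μ θ)) :=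
  Submodule.subset_span ⟨(0, k), by simp [monomial]⟩

theorem W_mul_mem {x : AZero μ θ} (hx : x ∈ Submodule.span ℂ (Set.range (monomial μ θ))) :
    W μ θ * x ∈ Submodule.span ℂ (Set.range (monomial μ θ)) := by
  refine mul_mem_of_commute_up_to_scalar W_mul_L W_mul_star_L ?_ hx
  rintro (n | n)
  · convert starZPow_W_mem (μ := μ) (θ := θ) (Int.ofNat (n + 1)) using 1
    simp only [starZPow, pow_succ']
  · have h : star (W μ θ) ^ n ∈ Submodule.span ℂ (Set.range (monomial μ θ)) := by
      cases n with
      | zero => exact starZPow_W_mem (Int.ofNat 0)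
      | succ n => exact starZPow_W_mem (Int.negSucc n)
    simp only [starZPow, pow_succ', ← mul_assoc, W_mul_star_W, add_mul, smul_mul_assoc, one_mul]
    exact add_mem (add_mem (Submodule.smul_mem _ _ (L_mul_mem h))
      (Submodule.smul_mem _ _ (star_L_mul_mem h))) (Submodule.smul_mem _ _ h)

theorem star_W_mul_mem {x : AZero μ θ} (hx : x ∈ Submodule.span ℂ (Set.range (monomial μ θ))) :
    star (W μ θ) * x ∈ Submodule.span ℂ (Set.range (monomial μ θ)) := by
  refine mul_mem_of_commute_up_to_scalar star_W_mul_L star_W_mul_star_L ?_ hx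
  rintro ((_ | n) | n)
  · convert starZPow_W_mem (μ := μ) (θ := θ) (Int.negSucc 0) using 1
    simp [starZPow]
  · have h := starZPow_W_mem (μ := μ) (θ := θ) (Int.ofNat n)
    simp only [starZPow, pow_succ', ← mul_assoc, star_W_mul_W, add_mul, sub_mul, neg_mul,
      smul_mul_assoc, one_mul] at h ⊢
    exact add_mem (sub_mem (neg_mem (Submodule.smul_mem _ _ (L_mul_mem h)))
      (Submodule.smul_mem _ _ (star_L_mul_mem h))) (Submodule.smul_mem _ _ h)
  · convert starZPow_W_mem (μ := μ) (θ := θ) (Int.negSucc (n + 1)) using 1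
    simp only [starZPow, pow_succ']

theorem span_monomial : Submodule.span ℂ (Set.range (monomial μ θ)) = ⊤ := by
  have key : ∀ (a : Free) (x : AZero μ θ), x ∈ Submodule.span ℂ (Set.range (monomial μ θ)) →
      mk μ θ a * x ∈ Submodule.span ℂ (Set.range (monomial μ θ)) := by
    intro a
    induction a using FreeStarAlg.induct with
    | scalar c =>
      intro x hx
      rw [AlgHom.commutes, ← Algebra.smul_def]
      exact Submodule.smul_mem _ _ hx
    | gen s =>
      intro x hx
      rcases s with (_ | _) | (_ | _)
      · exact W_mul_mem hx
      · exact L_mul_mem hx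
      · have e : FreeStarAlg.letter (Sum.inr AGen.W) = star fW :=
          (FreeStarAlg.star_letter (Sum.inl AGen.W)).symm
        rw [e]
        exact star_W_mul_mem hx
      · have e : FreeStarAlg.letter (Sum.inr AGen.L) = star fL :=
          (FreeStarAlg.star_letter (Sum.inl AGen.L)).symm
        rw [e]
        exact star_L_mul_mem hx
    | mul a b ha hb =>
      intro x hx
      rw [map_mul, mul_assoc]
      exact ha _ (hb _ hx)
    | add a b ha hb =>
      intro x hx
      rw [map_add, add_mul]
      exact add_mem (ha _ hx) (hb _ hx)
  refine eq_top_iff.2 fun x _ => ?_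
  obtain ⟨a, rfl⟩ := mk_surjective x
  simpa using key a 1 (starZPow_W_mem 0)

end AZero

/-! ### The homomorphism into the noncommutative torus -/

open NCTorus in
theorem exists_hom_AZero_NCTorus {μ θ : ℝ} (hR : 0 ≤ R μ θ) :
    ∃ φ : AZero μ θ →⋆ₐ[ℂ] NCTorus θ,
      φ (AZero.W μ θ) = CFC.sqrt (R μ θ) * V θ ∧ φ (AZero.L μ θ) = U θ := by
  have hS : star (CFC.sqrt (R μ θ)) = CFC.sqrt (R μ θ) :=
    (IsSelfAdjoint.of_nonneg (CFC.sqrt_nonneg _)).star_eq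
  have hSS := CFC.sqrt_mul_sqrt_self _ hR
  have hc := (commute_sqrt_R_U μ θ).eq
  set S := CFC.sqrt (R μ θ)
  have hq : qPar θ * star (qPar θ) = 1 := qPar_mul_star θ
  have hWL : S * V θ * U θ = qPar θ • (U θ * (S * V θ)) := by
    rw [mul_assoc, V_mul_U, mul_smul_comm, ← mul_assoc, hc, mul_assoc]
  have hWsL : star (V θ) * S * U θ = star (qPar θ) • (U θ * (star (V θ) * S)) := by
    rw [mul_assoc, hc, ← mul_assoc, star_V_mul_U, smul_mul_assoc, mul_assoc]
  -- the relations involving `Λ*` are adjoints of those involving `Λ`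
  have hWLs : S * V θ * star (U θ) = star (qPar θ) • (star (U θ) * (S * V θ)) := by
    have h := congrArg star hWsL
    simp only [star_mul, star_smul, star_star, hS] at h
    rw [h, smul_smul, mul_comm, hq, one_smul]
  have hWsLs : star (V θ) * S * star (U θ) = qPar θ • (star (U θ) * (star (V θ) * S)) := by
    have h := congrArg star hWL
    simp only [star_mul, star_smul, hS] at h
    rw [h, smul_smul, hq, one_smul]
  have hWWs : S * V θ * (star (V θ) * S) = R μ θ := by
    rw [mul_assoc, ← mul_assoc (V θ), V_mul_star_V, one_mul, hSS]
  have hWsW : star (V θ) * S * (S * V θ) = star (V θ) * R μ θ * V θ := by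
    rw [mul_assoc, ← mul_assoc S, hSS, mul_assoc]
  have hz := star_qPar_mul_zPar θ
  have hz' : qPar θ * star (zPar θ) = -zPar θ := by
    have h := congrArg star hz
    rwa [star_mul, star_neg, star_star, star_star, mul_comm] at h
  refine AZero.exists_lift (fun g => match g with
    | .W => S * V θ
    | .L => U θ) fun r hr => ?_
  cases hr <;> simp only [map_sub, map_add, map_neg, map_mul, map_smul, map_one, map_star,
    FreeStarAlg.lift_of, star_mul, hS]
  · rw [hWL, sub_self]
  · rw [hWsL, sub_self]
  · rw [hWsLs, sub_self]
  · rw [hWLs, sub_self]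
  · rw [star_U_mul_U, sub_self]
  · rw [U_mul_star_U, sub_self]
  · rw [hWWs, R]; abel
  · rw [hWsW, star_V_mul_R_mul_V, hz, hz', neg_smul, neg_smul]; abel

/-- The images of the monomials `Λⁿ Wᵏ` are linearly independent: the action `V ↦ bV` separates the
exponents `k`, and for fixed `k` the invertible factor `φ(Wᵏ)` cancels. -/
theorem linearIndependent_map_monomial {μ θ : ℝ} (hR : IsStrictlyPositive (NCTorus.R μ θ))
    {φ : AZero μ θ →⋆ₐ[ℂ] NCTorus θ}
    (hW : φ (AZero.W μ θ) = CFC.sqrt (NCTorus.R μ θ) * NCTorus.V θ)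
    (hL : φ (AZero.L μ θ) = NCTorus.U θ) :
    LinearIndependent ℂ fun p => φ (AZero.monomial μ θ p) := by
  set X := CFC.sqrt (NCTorus.R μ θ) * NCTorus.V θ
  have hXu : IsUnit X := (IsStrictlyPositive.isUnit_cfcSqrt _ hR).mul
    ⟨⟨NCTorus.V θ, star (NCTorus.V θ), NCTorus.V_mul_star_V θ, NCTorus.star_V_mul_V θ⟩, rfl⟩
  have hX : ∀ b, NCTorus.gauge θ 1 b X = (b : ℂ) • X := fun b => by
    rw [map_mul, NCTorus.gauge_sqrt_R hR.nonneg, NCTorus.gauge_V, mul_smul_comm]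
  have hm : ∀ p, φ (AZero.monomial μ θ p)
      = ((NCTorus.unitU θ ^ p.1 : (NCTorus θ)ˣ) : NCTorus θ) * starZPow X p.2 := fun p => by
    have hu : Units.map (φ : AZero μ θ →* NCTorus θ) (AZero.unitL μ θ) = NCTorus.unitU θ :=
      Units.ext hL
    rw [AZero.monomial, map_mul, map_starZPow, hW, ← hu, ← map_zpow]
    rfl
  refine linearIndependent_iff'.2 fun s g h p hp => ?_
  have h1 := sum_weight_eq_zero (fun b => (NCTorus.gauge θ 1 b).toAlgHom.toLinearMap)
    (d := Prod.snd) (fun b p => ?_) h p.2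
  · simp only [hm] at h1
    have h2 : (∑ i ∈ s with i.2 = p.2,
        g i • ((NCTorus.unitU θ ^ i.1 : (NCTorus θ)ˣ) : NCTorus θ)) * starZPow X p.2 = 0 := by
      rw [← h1, Finset.sum_mul]
      refine Finset.sum_congr rfl fun i hi => ?_
      rw [(Finset.mem_filter.1 hi).2, smul_mul_assoc]
    rw [(isUnit_starZPow hXu _).mul_left_eq_zero] at h2
    have hi : Function.Injective fun i : {i : ℤ × ℤ // i.2 = p.2} => i.1.1 :=
      fun i j hij => Subtype.ext (Prod.ext hij (i.2.trans j.2.symm))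
    have h3 := linearIndependent_iff'.1 ((NCTorus.linearIndependent_unitU_zpow (θ := θ)).comp _ hi)
      (s.subtype fun i => i.2 = p.2) (fun i => g i) ?_ ⟨p, rfl⟩ (Finset.mem_subtype.2 hp)
    · exact h3
    rw [← h2, ← Finset.sum_subtype_eq_sum_filter]
    rfl
  · change NCTorus.gauge θ 1 b (φ _) = _
    rw [hm, map_mul, map_starZPow, hX, starZPow_circle_smul, NCTorus.gauge_unitU_zpow]
    simp

end

theorem proposition2 (μ θ : ℝ) (hμ : 0 < μ) (hμθ : 1 < |μ * Real.cos (Real.pi * θ)|) :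
    IsStrictlyPositive (NCTorus.R μ θ) ∧
    ∃ φ : AZero μ θ →⋆ₐ[ℂ] NCTorus θ,
      (φ (AZero.W μ θ) = CFC.sqrt (NCTorus.R μ θ) * NCTorus.V θ ∧
        φ (AZero.L μ θ) = NCTorus.U θ) ∧
      Function.Injective φ ∧
      ∀ ψ : AZero μ θ →⋆ₐ[ℂ] NCTorus θ,
        ψ (AZero.W μ θ) = CFC.sqrt (NCTorus.R μ θ) * NCTorus.V θ →
        ψ (AZero.L μ θ) = NCTorus.U θ → ψ = φ := by
  have hR := NCTorus.isStrictlyPositive_R hμ hμθ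
  obtain ⟨φ, hW, hL⟩ := exists_hom_AZero_NCTorus hR.nonneg
  refine ⟨hR, φ, ⟨hW, hL⟩, ?_, fun ψ h1 h2 => AZero.hom_ext (h1.trans hW.symm) (h2.trans hL.symm)⟩
  refine (injective_iff_map_eq_zero φ).2 fun x hx => ?_
  have hx' : x ∈ Submodule.span ℂ (Set.range (AZero.monomial μ θ)) := by
    rw [AZero.span_monomial]; trivial
  obtain ⟨c, rfl⟩ := Finsupp.mem_span_range_iff_exists_finsupp.1 hx'
  rw [Finsupp.sum, map_sum] at hx
  simp only [map_smul] at hx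
  have h0 := linearIndependent_iff'.1 (linearIndependent_map_monomial hR hW hL) c.support c hx
  exact Finset.sum_eq_zero fun p hp => by simp only [h0 p hp, zero_smul]
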